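/- A $*$-category is a category with an operation taking each morphism $f\colon X\to Y$ to a morphism $f^*\colon Y\to X$ such that $1^*=1$, $(gf)^*=f^*g^*$ and $(f^*)^*=f$. A morphism $f$ is isometric if $f^*f=1$ and coisometric if $ff^*=1$. In a $*$-category with a zero object, an orthonormal product of $X_1$ and $X_2$ is a product whose projections $r_1,r_2$ are coisometric and satisfy $r_1r_2^*=0$. A pre-Hilbert $*$-category is a $*$-category with a zero object and binary orthonormal products, in which every morphism has an isometric kernel and every diagonal $\langle 1,1\rangle\colon X\to X\oplus X$ is a kernel. Orthonormal products are biproducts, so parallel morphisms can be added. An endomorphism $a$ is Hermitian if $a^*=a$; the Hermitian endomorphisms of an object $A$ are ordered by $a\le b$ if and only if $b=a+h^*h$ for some object $Z$ and some morphism $h\colon A\to Z$. Upper bounds and suprema below are taken in this ordered set. Let $\mathcal C$ be a pre-Hilbert $*$-category and let $(X_j)_{j\in J}$ be a family of objects of $\mathcal C$ indexed by an arbitrary set $J$. A span $(g_j\colon Y\to X_j)_{j\in J}$ is an $\ell^2$-span if the net $\bigl(\sum_{j\in F}g_j^*g_j\bigr)_F$, indexed by the finite subsets $F$ of $J$, is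 bounded above. An $\ell^2$-product of $(X_j)_{j\in J}$ is an $\ell^2$-span $(r_j\colon X\to X_j)_{j\in J}$ such that for every $\ell^2$-span $(g_j\colon Y\to X_j)_{j\in J}$ there is a unique morphism $g\colon Y\to X$ with $r_jg=g_j$ for all $j\in J$, and, additionally, this $g$ satisfies $g^*g=\sup_F\sum_{j\in F}g_j^*g_j$ (in particular this supremum exists). An $\ell^2$-biproduct of $(X_j)_{j\in J}$ is a span $(r_j\colon X\to X_j)_{j\in J}$ such that $r_jr_j^*=1$ for all $j\in J$, $r_jr_k^*=0$ for all $j\neq k$ in $J$, and $\sup_F\sum_{j\in F}r_j^*r_j=1$. **Proposition.** In a pre-Hilbert $*$-category, every $\ell^2$-product $(r_j\colon X\to X_j)_{j\in J}$ is an $\ell^2$-biproduct. That is, $r_jr_j^*=1$ for all $j$, $r_jr_k^*=0$ for $j\ne k$, and the supremum over the finite subsets $F\subseteq J$ of the sums $\sum_{j\in F}r_j^*r_j$ exists and equals $1$. -/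

import Mathlib

open CategoryTheory CategoryTheory.Limits

universe w v u

/-- A `∗`-category: a category with a contravariant, identity-on-objects involution
`f ↦ f∗` on morphisms, here written `adj f`.  Recall that `f ≫ g` is the composite `g f`. -/
class StarCategory (C : Type u) [Category.{v} C] where
  /-- The involution. -/
  adj : ∀ {X Y : C}, (X ⟶ Y) → (Y ⟶ X)
  adj_id : ∀ X : C, adj (𝟙 X) = 𝟙 X
  adj_comp : ∀ {X Y Z : C} (f : X ⟶ Y) (g : Y ⟶ Z), adj (f ≫ g) = adj g ≫ adj f
  adj_adj : ∀ {X Y : C} (f : X ⟶ Y), adj (adj f) = f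

namespace StarCategory

section Basic

variable {C : Type u} [Category.{v} C] [StarCategory C]

/-- `f` is isometric: `f∗ f = 1`. -/
def IsIsometric {X Y : C} (f : X ⟶ Y) : Prop := f ≫ adj f = 𝟙 X

/-- `f` is coisometric: `f f∗ = 1`. -/
def IsCoisometric {X Y : C} (f : X ⟶ Y) : Prop := adj f ≫ f = 𝟙 Y

/-- An endomorphism `a` is Hermitian: `a∗ = a`. -/
def IsHermitian {A : C} (a : A ⟶ A) : Prop := adj a = a

/-- An orthonormal product of `X₁` and `X₂`: a product whose projections are coisometries
with `r₁ r₂∗ = 0`. -/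
structure IsOrthonormalProduct [HasZeroMorphisms C] {X₁ X₂ P : C}
    (r₁ : P ⟶ X₁) (r₂ : P ⟶ X₂) : Prop where
  isLimit : Nonempty (IsLimit (BinaryFan.mk r₁ r₂))
  coisometric_fst : IsCoisometric r₁
  coisometric_snd : IsCoisometric r₂
  orthogonal : adj r₂ ≫ r₁ = 0

/-- `k` is a kernel of `f`. -/
def IsKernelOf [HasZeroMorphisms C] {K X Y : C} (k : K ⟶ X) (f : X ⟶ Y) : Prop :=
  ∃ hk : k ≫ f = 0, Nonempty (IsLimit (KernelFork.ofι k hk))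

end Basic

end StarCategory

open StarCategory in
/-- A pre-Hilbert `∗`-category: a `∗`-category with a zero object, binary orthonormal products
and isometric kernels, in which every diagonal `⟨1, 1⟩ : X ⟶ X ⊕ X` is a kernel.  (The zero
morphisms are the ones through the zero object; they form a unique structure.) -/
class PreHilbertStarCategory (C : Type u) [Category.{v} C] [HasZeroMorphisms C]
    [StarCategory C] : Prop where
  hasZeroObject : HasZeroObject C
  exists_orthonormalProduct : ∀ X₁ X₂ : C,
    ∃ (P : C) (r₁ : P ⟶ X₁) (r₂ : P ⟶ X₂), IsOrthonormalProduct r₁ r₂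
  exists_isometric_kernel : ∀ {X Y : C} (f : X ⟶ Y),
    ∃ (K : C) (k : K ⟶ X), IsIsometric k ∧ IsKernelOf k f
  diagonal_isKernel : ∀ {X P : C} (r₁ r₂ : P ⟶ X), IsOrthonormalProduct r₁ r₂ →
    ∀ d : X ⟶ P, d ≫ r₁ = 𝟙 X → d ≫ r₂ = 𝟙 X →
      ∃ (Z : C) (f : P ⟶ Z), IsKernelOf d f

namespace PreHilbertStarCategory

open StarCategory

variable {C : Type u} [Category.{v} C] [HasZeroMorphisms C] [StarCategory C]

theorem adj_zero (X Y : C) : adj (0 : X ⟶ Y) = 0 := by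
  have h : adj (0 : X ⟶ Y) = adj ((0 : X ⟶ X) ≫ adj (0 : Y ⟶ X)) := by simp
  rw [h, adj_comp, adj_adj, zero_comp]

theorem adj_comp_eq_zero {X₁ X₂ P : C} {r₁ : P ⟶ X₁} {r₂ : P ⟶ X₂}
    (h : IsOrthonormalProduct r₁ r₂) : adj r₁ ≫ r₂ = 0 := by
  have := congrArg adj h.orthogonal
  rwa [adj_comp, adj_adj, adj_zero] at this

/-- An orthonormal product, together with the adjoints of its projections, is a biproduct. -/
theorem hasBinaryBiproduct_of_isOrthonormalProduct {X₁ X₂ P : C} {r₁ : P ⟶ X₁} {r₂ : P ⟶ X₂}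
    (h : IsOrthonormalProduct r₁ r₂) : HasBinaryBiproduct X₁ X₂ := by
  obtain ⟨hl⟩ := h.isLimit
  have colift : ∀ {T : C} (f : X₁ ⟶ T) (g : X₂ ⟶ T),
      ∃ m : P ⟶ T, adj r₁ ≫ m = f ∧ adj r₂ ≫ m = g := by
    intro T f g
    have : ∃ l : T ⟶ P, l ≫ r₁ = adj f ∧ l ≫ r₂ = adj g :=
      ⟨_, (BinaryFan.IsLimit.lift' hl (adj f) (adj g)).2⟩
    obtain ⟨l, h₁, h₂⟩ := this
    exact ⟨adj l, by rw [← adj_comp, h₁, adj_adj], by rw [← adj_comp, h₂, adj_adj]⟩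
  have colift_unique : ∀ {T : C} (m n : P ⟶ T), adj r₁ ≫ m = adj r₁ ≫ n →
      adj r₂ ≫ m = adj r₂ ≫ n → m = n := by
    intro T m n h₁ h₂
    have h₁' : adj m ≫ r₁ = adj n ≫ r₁ := by
      simpa only [adj_comp, adj_adj] using congrArg adj h₁
    have h₂' : adj m ≫ r₂ = adj n ≫ r₂ := by
      simpa only [adj_comp, adj_adj] using congrArg adj h₂
    have : adj m = adj n := BinaryFan.IsLimit.hom_ext hl h₁' h₂'
    rw [← adj_adj m, this, adj_adj]
  choose c hc₁ hc₂ using @colift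
  exact HasBinaryBiproduct.mk
    { bicone :=
        { pt := P, fst := r₁, snd := r₂, inl := adj r₁, inr := adj r₂
          inl_fst := h.coisometric_fst
          inl_snd := adj_comp_eq_zero h
          inr_fst := h.orthogonal
          inr_snd := h.coisometric_snd }
      isBilimit :=
        { isLimit := hl
          isColimit := BinaryCofan.IsColimit.mk _ (fun f g => c f g) (fun f g => hc₁ f g)
            (fun f g => hc₂ f g) (fun f g m h₁ h₂ => colift_unique m (c f g)
              (h₁.trans (hc₁ f g).symm) (h₂.trans (hc₂ f g).symm)) } }

variable [PreHilbertStarCategory C]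

instance hasBinaryBiproducts : HasBinaryBiproducts C where
  has_binary_biproduct X₁ X₂ := by
    obtain ⟨P, r₁, r₂, h⟩ := exists_orthonormalProduct X₁ X₂
    exact hasBinaryBiproduct_of_isOrthonormalProduct h

/-- The canonical addition of parallel morphisms: `f + g` is the composite
`X ⟶ X ⊕ X ⟶ Y` of the diagonal and the copairing of `f` and `g`. -/
noncomputable instance homAddCommMonoid (X Y : C) : AddCommMonoid (X ⟶ Y) :=
  SemiadditiveOfBinaryBiproducts.addCommMonoidHomOfHasBinaryBiproducts X Y

/-- The order on Hermitian endomorphisms: `a ≤ b` when `b - a = h∗ h` for some morphism `h`. -/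
def HermitianLE {A : C} (a b : A ⟶ A) : Prop :=
  ∃ (X : C) (h : A ⟶ X), b = a + h ≫ adj h

/-- `b` is an upper bound, among the Hermitian endomorphisms of `A`, of the family `a`. -/
def IsUpperBound {A : C} {ι : Type w} (a : ι → (A ⟶ A)) (b : A ⟶ A) : Prop :=
  IsHermitian b ∧ ∀ i, HermitianLE (a i) b

/-- `s` is the supremum, in the ordered set of Hermitian endomorphisms of `A`, of the
family `a`. -/
def IsSupremum {A : C} {ι : Type w} (a : ι → (A ⟶ A)) (s : A ⟶ A) : Prop :=
  IsUpperBound a s ∧ ∀ b, IsUpperBound a b → HermitianLE s b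

/-- The net `F ↦ ∑_{j ∈ F} g_j∗ g_j`, indexed by the finite subsets of `J`, of a span `g`. -/
noncomputable def partialSums {J : Type w} {X : J → C} {Y : C} (g : ∀ j, Y ⟶ X j) :
    Finset J → (Y ⟶ Y) :=
  fun F => ∑ j ∈ F, g j ≫ adj (g j)

/-- An `ℓ²`-span: the net of partial sums is bounded above. -/
def IsL2Span {J : Type w} {X : J → C} {Y : C} (g : ∀ j, Y ⟶ X j) : Prop :=
  ∃ b : Y ⟶ Y, IsUpperBound (partialSums g) b

/-- An `ℓ²`-product of the family `X`. -/
structure IsL2Product {J : Type w} {X : J → C} {P : C} (r : ∀ j, P ⟶ X j) : Prop where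
  isL2Span : IsL2Span r
  existsUnique : ∀ (Y : C) (g : ∀ j, Y ⟶ X j), IsL2Span g →
    ∃! m : Y ⟶ P, ∀ j, m ≫ r j = g j
  isSupremum : ∀ (Y : C) (g : ∀ j, Y ⟶ X j), IsL2Span g →
    ∀ m : Y ⟶ P, (∀ j, m ≫ r j = g j) → IsSupremum (partialSums g) (m ≫ adj m)

/-- An `ℓ²`-biproduct of the family `X`: `r_j r_k∗ = δ_{jk}` and
`sup_F ∑_{j ∈ F} r_j∗ r_j = 1`. -/
structure IsL2Biproduct {J : Type w} {X : J → C} {P : C} (r : ∀ j, P ⟶ X j) : Prop where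
  coisometric : ∀ j, adj (r j) ≫ r j = 𝟙 (X j)
  orthogonal : ∀ j k, j ≠ k → adj (r k) ≫ r j = 0
  isSupremum : IsSupremum (partialSums r) (𝟙 P)

end PreHilbertStarCategory

namespace PreHilbertStarCategory

open StarCategory

variable {C : Type u} [Category.{v} C] [HasZeroMorphisms C]

/-! The span `r` is induced by the identity, so its partial sums have supremum 1; in particular
`r_k∗ r_k ≤ 1`. The span on `X k` with identity at `k` and zeros elsewhere induces `m` with `r_j m =
δ_jk`, and leastness of the supremum gives `m∗ m ≤ 1`. It remains to see that `m = r_k∗`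
(`eq_adj_of_hermitianLE`). Write `1 = r_k∗ r_k + h∗ h` and `1 = m∗ m + l∗ l`. Then `m∗ m = 1 +
(hm)∗(hm)`, hence `1 = 1 + (hm)∗(hm) + l∗ l`. Cancellation (`eq_zero_of_add_eq_self`) and anisotropy
yield `hm = 0`, so `m = r_k∗ r_k m = r_k∗`. -/

open Classical in
/-- The span on `X k` whose component at `k` is the identity and whose other components vanish. -/
noncomputable def diracSpan {J : Type w} (X : J → C) (k : J) : ∀ j, X k ⟶ X j :=
  fun j => if h : k = j then eqToHom (congrArg X h) else 0

theorem diracSpan_self {J : Type w} (X : J → C) (k : J) : diracSpan X k k = 𝟙 (X k) := by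
  simp [diracSpan]

theorem diracSpan_of_ne {J : Type w} (X : J → C) {j k : J} (h : k ≠ j) :
    diracSpan X k j = 0 := by
  simp [diracSpan, h]

variable [StarCategory C] [PreHilbertStarCategory C]

theorem add_comp_hom {X Y Z : C} (f g : X ⟶ Y) (h : Y ⟶ Z) :
    (f + g) ≫ h = f ≫ h + g ≫ h :=
  SemiadditiveOfBinaryBiproducts.add_comp f g h

theorem comp_add_hom {X Y Z : C} (f : X ⟶ Y) (g h : Y ⟶ Z) :
    f ≫ (g + h) = f ≫ g + f ≫ h :=
  SemiadditiveOfBinaryBiproducts.comp_add f g h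

theorem zero_add_hom {X Y : C} (f : X ⟶ Y) : (0 : X ⟶ Y) + f = f :=
  zero_add f

theorem add_zero_hom {X Y : C} (f : X ⟶ Y) : f + (0 : X ⟶ Y) = f :=
  add_zero f

/-- The projections of an orthonormal product resolve the identity. -/
theorem orthonormalProduct_total {X₁ X₂ P : C} {r₁ : P ⟶ X₁} {r₂ : P ⟶ X₂}
    (h : IsOrthonormalProduct r₁ r₂) : r₁ ≫ adj r₁ + r₂ ≫ adj r₂ = 𝟙 P := by
  obtain ⟨hl⟩ := h.isLimit
  have h₁ : adj r₁ ≫ r₁ = 𝟙 X₁ := h.coisometric_fst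
  have h₂ : adj r₂ ≫ r₂ = 𝟙 X₂ := h.coisometric_snd
  refine BinaryFan.IsLimit.hom_ext hl ?_ ?_
  · change (r₁ ≫ adj r₁ + r₂ ≫ adj r₂) ≫ r₁ = 𝟙 P ≫ r₁
    rw [add_comp_hom, Category.assoc, Category.assoc, h₁, h.orthogonal, comp_zero, add_zero_hom,
      Category.comp_id, Category.id_comp]
  · change (r₁ ≫ adj r₁ + r₂ ≫ adj r₂) ≫ r₂ = 𝟙 P ≫ r₂
    rw [add_comp_hom, Category.assoc, Category.assoc, h₂, adj_comp_eq_zero h, comp_zero,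
      zero_add_hom, Category.comp_id, Category.id_comp]

/-- A pre-Hilbert `∗`-category is anisotropic: `f∗ f = 0` implies `f = 0`. -/
theorem eq_zero_of_comp_adj_eq_zero {X Y : C} {f : X ⟶ Y} (hf : f ≫ adj f = 0) : f = 0 := by
  obtain ⟨K, k, hk, hkf, ⟨hl⟩⟩ := exists_isometric_kernel (adj f)
  obtain ⟨l, hl⟩ : ∃ l : X ⟶ K, l ≫ k = f := ⟨_, (KernelFork.IsLimit.lift' hl f hf).2⟩
  have hk' : k ≫ adj k = 𝟙 K := hk
  -- As `k` is isometric, `l∗ = f∗ k`, which vanishes because `k` is a kernel of `f∗`.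
  have hl₀ : k ≫ adj f = adj l := by
    rw [← hl, adj_comp, ← Category.assoc, hk', Category.id_comp]
  have : l = 0 := by
    rw [← adj_adj l, ← hl₀, hkf, adj_zero]
  rw [← hl, this, zero_comp]

/-- The pairing `p = ⟨f, g⟩` into an orthonormal product satisfies `p∗ p = f∗ f + g∗ g`, so
anisotropy applies to `p`. -/
theorem eq_zero_of_comp_adj_add_comp_adj_eq_zero {X Y Z : C} {f : X ⟶ Y} {g : X ⟶ Z}
    (h : f ≫ adj f + g ≫ adj g = 0) : f = 0 := by
  obtain ⟨P, r₁, r₂, hP⟩ := exists_orthonormalProduct Y Z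
  obtain ⟨hl⟩ := hP.isLimit
  obtain ⟨p, h₁, h₂⟩ : ∃ p : X ⟶ P, p ≫ r₁ = f ∧ p ≫ r₂ = g :=
    ⟨_, (BinaryFan.IsLimit.lift' hl f g).2⟩
  have hp : p ≫ adj p = 0 := by
    calc p ≫ adj p = p ≫ (r₁ ≫ adj r₁ + r₂ ≫ adj r₂) ≫ adj p := by
          rw [orthonormalProduct_total hP, Category.id_comp]
      _ = f ≫ adj f + g ≫ adj g := by
          rw [← h₁, ← h₂, add_comp_hom, comp_add_hom, adj_comp, adj_comp]
          simp only [Category.assoc]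
      _ = 0 := h
  rw [← h₁, eq_zero_of_comp_adj_eq_zero hp, zero_comp]

/-- Addition of morphisms is cancellative at zero, because diagonals are kernels. -/
theorem eq_zero_of_add_eq_self {X Y : C} {a b : X ⟶ Y} (h : a + b = a) : b = 0 := by
  obtain ⟨P, r₁, r₂, hP⟩ := exists_orthonormalProduct Y Y
  have h₁ : adj r₁ ≫ r₁ = 𝟙 Y := hP.coisometric_fst
  have h₂ : adj r₂ ≫ r₂ = 𝟙 Y := hP.coisometric_snd
  have hd₁ : (adj r₁ + adj r₂) ≫ r₁ = 𝟙 Y := by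
    rw [add_comp_hom, h₁, hP.orthogonal, add_zero_hom]
  have hd₂ : (adj r₁ + adj r₂) ≫ r₂ = 𝟙 Y := by
    rw [add_comp_hom, h₂, adj_comp_eq_zero hP, zero_add_hom]
  obtain ⟨Z, f, hdf, ⟨hl⟩⟩ := diagonal_isKernel r₁ r₂ hP _ hd₁ hd₂
  -- The two components of `f` are additive inverses, so the contribution of `a` cancels and `f`
  -- kills `⟨b, 0⟩`. This pair then factors through the diagonal, which forces `b = 0`.
  have hsum : a ≫ adj r₁ ≫ f + a ≫ adj r₂ ≫ f = 0 := by
    rw [← comp_add_hom, ← add_comp_hom, hdf, comp_zero]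
  have hb : (b ≫ adj r₁) ≫ f = 0 := by
    calc (b ≫ adj r₁) ≫ f
        = (a ≫ adj r₁ ≫ f + a ≫ adj r₂ ≫ f) + b ≫ adj r₁ ≫ f := by
          rw [hsum, zero_add_hom, Category.assoc]
      _ = (a + b) ≫ adj r₁ ≫ f + a ≫ adj r₂ ≫ f := by
          rw [add_comp_hom, add_right_comm]
      _ = 0 := by rw [h, hsum]
  obtain ⟨c, hc⟩ : ∃ c : X ⟶ Y, c ≫ (adj r₁ + adj r₂) = b ≫ adj r₁ :=
    ⟨_, (KernelFork.IsLimit.lift' hl _ hb).2⟩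
  have hcb : c = b := by
    have := congrArg (· ≫ r₁) hc
    simpa only [Category.assoc, hd₁, h₁, Category.comp_id] using this
  have hc0 : c = 0 := by
    have := congrArg (· ≫ r₂) hc
    simpa only [Category.assoc, hd₂, adj_comp_eq_zero hP, Category.comp_id, comp_zero] using this
  rw [← hcb, hc0]

theorem HermitianLE.refl {A : C} (a : A ⟶ A) : HermitianLE a a :=
  ⟨A, 0, by rw [zero_comp, add_zero_hom]⟩

theorem zero_hermitianLE_id (A : C) : HermitianLE (0 : A ⟶ A) (𝟙 A) :=
  ⟨A, 𝟙 A, by rw [adj_id, Category.comp_id, zero_add_hom]⟩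

theorem partialSums_diracSpan_hermitianLE {J : Type w} (X : J → C) (k : J) (F : Finset J) :
    HermitianLE (partialSums (diracSpan X k) F) (𝟙 (X k)) := by
  by_cases hk : k ∈ F
  · have : partialSums (diracSpan X k) F = 𝟙 (X k) := by
      refine (Finset.sum_eq_single_of_mem k hk fun j _ hj => ?_).trans ?_
      · rw [diracSpan_of_ne X hj.symm, zero_comp]
      · rw [diracSpan_self, adj_id, Category.comp_id]
    rw [this]
    exact HermitianLE.refl _
  · have : partialSums (diracSpan X k) F = 0 := by
      refine Finset.sum_eq_zero fun j hj => ?_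
      rw [diracSpan_of_ne X (fun h : k = j => hk (h.symm ▸ hj)), zero_comp]
    rw [this]
    exact zero_hermitianLE_id _

/-- Used twice: it makes `diracSpan` an `ℓ²`-span, and it bounds `m∗ m` by 1 for the induced
morphism `m`. -/
theorem isUpperBound_diracSpan {J : Type w} (X : J → C) (k : J) :
    IsUpperBound (partialSums (diracSpan X k)) (𝟙 (X k)) :=
  ⟨adj_id _, partialSums_diracSpan_hermitianLE X k⟩

/-- A section `m` of a contraction `r` with `m∗ m ≤ 1` is the adjoint of `r`. -/
theorem eq_adj_of_hermitianLE {X P : C} {r : P ⟶ X} {m : X ⟶ P} (hmr : m ≫ r = 𝟙 X)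
    (hr : HermitianLE (r ≫ adj r) (𝟙 P)) (hm : HermitianLE (m ≫ adj m) (𝟙 X)) :
    m = adj r := by
  obtain ⟨Z, h, hh⟩ := hr
  obtain ⟨W, l, hl⟩ := hm
  have hexp : m ≫ adj m = 𝟙 X + (m ≫ h) ≫ adj (m ≫ h) := by
    calc m ≫ adj m = m ≫ (r ≫ adj r + h ≫ adj h) ≫ adj m := by rw [← hh, Category.id_comp]
      _ = (m ≫ r) ≫ adj (m ≫ r) + (m ≫ h) ≫ adj (m ≫ h) := by
          rw [add_comp_hom, comp_add_hom, adj_comp, adj_comp]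
          simp only [Category.assoc]
      _ = 𝟙 X + (m ≫ h) ≫ adj (m ≫ h) := by rw [hmr, adj_id, Category.comp_id]
  have hmh : m ≫ h = 0 := by
    refine eq_zero_of_comp_adj_add_comp_adj_eq_zero (g := l) (eq_zero_of_add_eq_self (a := 𝟙 X) ?_)
    rw [← add_assoc, ← hexp, ← hl]
  calc m = m ≫ (r ≫ adj r + h ≫ adj h) := by rw [← hh, Category.comp_id]
    _ = (m ≫ r) ≫ adj r + (m ≫ h) ≫ adj h := by
        rw [comp_add_hom, Category.assoc, Category.assoc]
    _ = adj r := by rw [hmr, hmh, Category.id_comp, zero_comp, add_zero_hom]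

namespace IsL2Product

variable {J : Type w} {X : J → C} {P : C} {r : ∀ j, P ⟶ X j}

theorem isSupremum_id (hr : IsL2Product r) : IsSupremum (partialSums r) (𝟙 P) := by
  have := hr.isSupremum P r hr.isL2Span (𝟙 P) fun j => Category.id_comp _
  rwa [adj_id, Category.comp_id] at this

theorem comp_adj_hermitianLE (hr : IsL2Product r) (j : J) :
    HermitianLE (r j ≫ adj (r j)) (𝟙 P) := by
  have := hr.isSupremum_id.1.2 {j}
  rwa [partialSums, Finset.sum_singleton] at this

/-- The adjoint of a projection of an `ℓ²`-product is the corresponding injection. -/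
theorem adj_comp_eq_diracSpan (hr : IsL2Product r) (k j : J) :
    adj (r k) ≫ r j = diracSpan X k j := by
  have hspan : IsL2Span (diracSpan X k) := ⟨_, isUpperBound_diracSpan X k⟩
  obtain ⟨m, hm, -⟩ := hr.existsUnique (X k) _ hspan
  have hmk : m = adj (r k) :=
    eq_adj_of_hermitianLE ((hm k).trans (diracSpan_self X k)) (hr.comp_adj_hermitianLE k)
      ((hr.isSupremum _ _ hspan m hm).2 _ (isUpperBound_diracSpan X k))
  rw [← hmk, hm]

end IsL2Product

end PreHilbertStarCategory

theorem mainTheorem7 {C : Type u} [Category.{v} C] [HasZeroMorphisms C] [StarCategory C]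
    [PreHilbertStarCategory C] {J : Type w} (X : J → C) (P : C) (r : ∀ j, P ⟶ X j)
    (hr : PreHilbertStarCategory.IsL2Product r) :
    PreHilbertStarCategory.IsL2Biproduct r where
  coisometric j := by
    rw [hr.adj_comp_eq_diracSpan, PreHilbertStarCategory.diracSpan_self]
  orthogonal j k h := by
    rw [hr.adj_comp_eq_diracSpan, PreHilbertStarCategory.diracSpan_of_ne X h.symm]
  isSupremum := hr.isSupremum_id
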